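/- Let $p$ be a prime, let $N$ be a positive integer coprime to $p$, and let $k$ be an integer. Let $S=\mathcal{S}_k(\Gamma_0(pN))$ be the space of cusp forms of weight $k$ for $\Gamma_0(pN)$. The Atkin–Lehner operator $W_p$ on $S$ is $$(W_pf)(z)=p^{k/2}(pNcz+pd)^{-k}f\!\left(\frac{paz+b}{pNcz+pd}\right),$$ where $a,b,c,d$ are any integers with $pad-Nbc=1$. Let $S^{p\text{-old}}\subseteq S$ be the span of the forms $g(z)$ and $g(pz)$ with $g\in\mathcal{S}_k(\Gamma_0(N))$, and let $S^{p\text{-new}}$ be the orthogonal complement of $S^{p\text{-old}}$ in $S$ for the Petersson inner product. Then, for every choice of $a,b,c,d$ as above, $S$ is finite-dimensional, $W_p$ maps each of $S^{p\text{-new}}$ and $S^{p\text{-old}}$ into itself, and $$\mathrm{tr}_{S^{p\text{-new}}}W_p=\mathrm{tr}_{S}W_p .$$ Equivalently, $\mathrm{tr}_{S^{p\text{-old}}}W_p=0$. -/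

import Mathlib

open UpperHalfPlane MeasureTheory CongruenceSubgroup
open scoped MatrixGroups ModularForm Modular ConjAct Pointwise

/-- The complex vector space `S_k(Γ₀(M))` of cusp forms of weight `k` for `Γ₀(M)`. -/
abbrev CuspSpace (M : ℕ) (k : ℤ) : Type :=
  CuspForm ((Gamma0 M : Subgroup SL(2, ℤ)) : Subgroup (GL (Fin 2) ℝ)) k

/-! ### The Atkin-Lehner operator at `p` -/

/-- The Atkin-Lehner matrix at `p` of level `p * N` (for `p` coprime to `N`): the matrix with rows
`(p * a, b)` and `(p * N * c, p * d)`, of determinant `p`. -/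
noncomputable def atkinLehnerMatrix (p N : ℕ) [Fact p.Prime] (a b c d : ℤ)
    (h : (p : ℤ) * a * d - N * b * c = 1) : GL (Fin 2) ℝ :=
  Matrix.GeneralLinearGroup.mkOfDetNeZero
    !![(p : ℝ) * a, (b : ℝ); (p : ℝ) * N * c, (p : ℝ) * d] (by
      have hR : (p : ℝ) * a * d - N * b * c = 1 := by exact_mod_cast h
      have hp : (p : ℝ) ≠ 0 := by exact_mod_cast (Fact.out : p.Prime).ne_zero
      rw [Matrix.det_fin_two_of]
      have : (p : ℝ) * a * (p * d) - b * (p * N * c) = p := by linear_combination (p : ℝ) * hR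
      rwa [this])

/-- Atkin-Lehner matrices exist when `p` is coprime to `N`. -/
theorem exists_atkinLehner_entries (p N : ℕ) (hpN : p.Coprime N) :
    ∃ a b c d : ℤ, (p : ℤ) * a * d - N * b * c = 1 := by
  refine ⟨1, -(p.gcdB N), 1, p.gcdA N, ?_⟩
  have h := Nat.gcd_eq_gcd_ab p N
  rw [hpN.gcd_eq_one] at h
  push_cast at h
  linear_combination -h

theorem atkinLehnerMatrix_det (p N : ℕ) [Fact p.Prime] (a b c d : ℤ)
    (h : (p : ℤ) * a * d - N * b * c = 1) :
    (atkinLehnerMatrix p N a b c d h).det.val = p := by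
  have hR : (p : ℝ) * a * d - N * b * c = 1 := by exact_mod_cast h
  change Matrix.det !![(p : ℝ) * a, (b : ℝ); (p : ℝ) * N * c, (p : ℝ) * d] = p
  rw [Matrix.det_fin_two_of]
  linear_combination (p : ℝ) * hR

/-- The Atkin-Lehner matrix conjugates `Γ₀(p * N)` into itself. -/
theorem Gamma0_le_conj_atkinLehnerMatrix (p N : ℕ) [Fact p.Prime] (a b c d : ℤ)
    (h : (p : ℤ) * a * d - N * b * c = 1) :
    ((Gamma0 (p * N) : Subgroup SL(2, ℤ)) : Subgroup (GL (Fin 2) ℝ)) ≤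
      ConjAct.toConjAct (atkinLehnerMatrix p N a b c d h)⁻¹ •
        ((Gamma0 (p * N) : Subgroup SL(2, ℤ)) : Subgroup (GL (Fin 2) ℝ)) := by
  rintro _ ⟨γ, hγ, rfl⟩
  have hγ' : ((γ 1 0 : ℤ) : ZMod (p * N)) = 0 := hγ
  rw [ZMod.intCast_zmod_eq_zero_iff_dvd] at hγ'
  obtain ⟨t, ht⟩ := hγ'
  push_cast at ht
  have hdet : γ 0 0 * γ 1 1 - γ 0 1 * γ 1 0 = 1 := by
    have := γ.det_coe
    rwa [Matrix.det_fin_two] at this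
  rw [ht] at hdet
  set α := γ 0 0 with hα
  set β := γ 0 1 with hβ
  set δ := γ 1 1 with hδ
  obtain ⟨γ₁, e₀₀, e₀₁, e₁₀, e₁₁⟩ : ∃ γ₁ : SL(2, ℤ),
      γ₁ 0 0 = d * (p * a * α + b * p * N * t) - N * c * (p * a * β + b * δ) ∧
      γ₁ 0 1 = -b * (a * α + b * N * t) + a * (p * a * β + b * δ) ∧
      γ₁ 1 0 = (p * N) * (d * (c * α + p * d * t) - c * (N * c * β + d * δ)) ∧
      γ₁ 1 1 = -b * N * (c * α + p * d * t) + p * a * (N * c * β + d * δ) := by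
    refine ⟨⟨!![d * (p * a * α + b * p * N * t) - N * c * (p * a * β + b * δ),
        -b * (a * α + b * N * t) + a * (p * a * β + b * δ);
        (p * N) * (d * (c * α + p * d * t) - c * (N * c * β + d * δ)),
        -b * N * (c * α + p * d * t) + p * a * (N * c * β + d * δ)], ?_⟩, rfl, rfl, rfl, rfl⟩
    rw [Matrix.det_fin_two_of]
    linear_combination (p * a * d - N * b * c) ^ 2 * hdet + (p * a * d - N * b * c + 1) * h
  have hmap : ∀ (g : SL(2, ℤ)) (i j : Fin 2),
      (Matrix.SpecialLinearGroup.mapGL ℝ g) i j = ((g i j : ℤ) : ℝ) := fun _ _ _ ↦ rfl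
  rw [Subgroup.mem_pointwise_smul_iff_inv_smul_mem]
  refine ⟨γ₁, ?_, ?_⟩
  · change ((γ₁ 1 0 : ℤ) : ZMod (p * N)) = 0
    rw [ZMod.intCast_zmod_eq_zero_iff_dvd, e₁₀]
    exact ⟨d * (c * α + p * d * t) - c * (N * c * β + d * δ), by push_cast; ring⟩
  · have hR : (p : ℝ) * a * d - N * b * c = 1 := by exact_mod_cast h
    have htR : ((γ 1 0 : ℤ) : ℝ) = p * N * t := by exact_mod_cast ht
    have hw : (atkinLehnerMatrix p N a b c d h : Matrix (Fin 2) (Fin 2) ℝ) =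
      !![(p : ℝ) * a, (b : ℝ); (p : ℝ) * N * c, (p : ℝ) * d] := rfl
    rw [← map_inv, inv_inv, ConjAct.toConjAct_smul, eq_mul_inv_iff_mul_eq]
    ext i j
    rw [Matrix.GeneralLinearGroup.coe_mul, Matrix.GeneralLinearGroup.coe_mul, hw,
      Matrix.mul_apply, Matrix.mul_apply, Fin.sum_univ_two, Fin.sum_univ_two]
    fin_cases i <;> fin_cases j <;>
      simp [hmap, e₀₀, e₀₁, e₁₀, e₁₁, ← hα, ← hβ, ← hδ, htR]
    · linear_combination ((p : ℝ) * a * α + b * p * N * t) * hR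
    · linear_combination ((p : ℝ) * a * β + b * δ) * hR
    · linear_combination ((p : ℝ) * N * c * α + p * d * p * N * t) * hR
    · linear_combination ((p : ℝ) * N * c * β + p * d * δ) * hR

/-- For `f ∈ S_k(Γ₀(p * N))` and an Atkin-Lehner matrix `w`, the cusp form `f ∣[k] w`. -/
noncomputable def atkinLehnerSlash (p N : ℕ) [Fact p.Prime] (k : ℤ) (a b c d : ℤ)
    (h : (p : ℤ) * a * d - N * b * c = 1) (f : CuspSpace (p * N) k) : CuspSpace (p * N) k where
  toFun := ⇑f ∣[k] atkinLehnerMatrix p N a b c d h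
  slash_action_eq' := fun γ hγ ↦
    (CuspForm.translate f (atkinLehnerMatrix p N a b c d h)).slash_action_eq' γ
      (Gamma0_le_conj_atkinLehnerMatrix p N a b c d h hγ)
  holo' := (CuspForm.translate f (atkinLehnerMatrix p N a b c d h)).holo'
  zero_at_cusps' := fun hc ↦
    (CuspForm.translate f (atkinLehnerMatrix p N a b c d h)).zero_at_cusps'
      (hc.mono (Gamma0_le_conj_atkinLehnerMatrix p N a b c d h))

theorem coe_atkinLehnerSlash (p N : ℕ) [Fact p.Prime] (k : ℤ) (a b c d : ℤ)
    (h : (p : ℤ) * a * d - N * b * c = 1) (f : CuspSpace (p * N) k) :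
    ⇑(atkinLehnerSlash p N k a b c d h f) = ⇑f ∣[k] atkinLehnerMatrix p N a b c d h :=
  rfl

/-- The Atkin-Lehner operator `W_p` on `S_k(Γ₀(p * N))`, computed with the Atkin-Lehner matrix `w`
with rows `(p * a, b)` and `(p * N * c, p * d)`: it maps `f` to `p ^ (1 - k / 2) • (f ∣[k] w)`.
Since Mathlib's slash action is normalised by
`(f ∣[k] g)(z) = det(g) ^ (k - 1) * (c z + d) ^ (-k) * f (g z)`, this is
`(W_p f)(z) = p ^ (k / 2) * (p N c z + p d) ^ (-k) * f (w z)`. -/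
noncomputable def atkinLehner (p N : ℕ) [Fact p.Prime] (k : ℤ) (a b c d : ℤ)
    (h : (p : ℤ) * a * d - N * b * c = 1) :
    CuspSpace (p * N) k →ₗ[ℂ] CuspSpace (p * N) k where
  toFun f := (((p : ℝ) ^ (1 - (k : ℝ) / 2) : ℝ) : ℂ) • atkinLehnerSlash p N k a b c d h f
  map_add' f g := by
    rw [← smul_add]
    congr 1
    apply DFunLike.coe_injective
    rw [FunLike.coe_add]
    simp only [coe_atkinLehnerSlash, FunLike.coe_add, SlashAction.add_slash]
  map_smul' r f := by
    rw [RingHom.id_apply, smul_comm]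
    congr 1
    apply DFunLike.coe_injective
    rw [FunLike.coe_smul]
    have hd : 0 < (atkinLehnerMatrix p N a b c d h).det.val := by
      rw [atkinLehnerMatrix_det]
      exact_mod_cast (Fact.out : p.Prime).pos
    simp only [coe_atkinLehnerSlash, FunLike.coe_smul, ModularForm.smul_slash]
    rw [σ, if_pos hd]
    rfl

/-! ### The Petersson inner product on `S_k(Γ₀(M))` -/

/-- The Petersson inner product
`⟨f, g⟩ = ∫_{Γ₀(M) \ ℍ} conj (f z) * g z * y ^ k * dx dy / y ^ 2`. The integral is taken over the
fundamental domain `⋃ γ⁻¹ 𝒟`, where `𝒟` is the standard fundamental domain of `SL(2, ℤ)` and `γ`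
runs through representatives of the cosets `γ Γ₀(M)` in `SL(2, ℤ)`. -/
noncomputable def peterssonInner {M : ℕ} {k : ℤ} (f g : CuspSpace M k) : ℂ :=
  ∑ᶠ q : SL(2, ℤ) ⧸ Gamma0 M, ∫ z in 𝒟, petersson k f g (q.out⁻¹ • z)

/-- The standard fundamental domain of `SL(2, ℤ)` has finite hyperbolic area. -/
theorem volume_fd_lt_top : volume (𝒟 : Set ℍ) < ⊤ := by
  have hsub : (UpperHalfPlane.coe '' (𝒟 : Set ℍ)) ⊆
      Complex.measurableEquivRealProd ⁻¹' (Set.Icc (-1 : ℝ) 1 ×ˢ Set.Ioi (1 / 2 : ℝ)) := by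
    rintro _ ⟨z, hz, rfl⟩
    have h1 := ModularGroup.three_le_four_mul_im_sq_of_mem_fd hz
    have h2 := abs_le.mp hz.2
    have h3 := z.im_pos
    refine ⟨⟨?_, ?_⟩, ?_⟩
    · change (-1 : ℝ) ≤ z.re
      linarith [h2.1]
    · change z.re ≤ 1
      linarith [h2.2]
    · change 1 / 2 < z.im
      nlinarith
  have hfin : ∫⁻ y in Set.Ioi (1 / 2 : ℝ), ((((1 / ‖y‖₊) ^ 2 : NNReal)) : ENNReal) < ⊤ := by
    have hi := (integrableOn_Ioi_rpow_of_lt (a := -2) (by norm_num)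
      (c := (1 / 2 : ℝ)) (by norm_num)).2
    refine lt_of_le_of_lt (le_of_eq ?_) hi
    refine setLIntegral_congr_fun measurableSet_Ioi fun y hy ↦ ?_
    have hy0 : 0 < y := lt_trans (by norm_num) hy
    rw [enorm_eq_nnnorm, ENNReal.coe_inj]
    ext
    simp [Real.rpow_neg hy0.le]
  rw [volume_eq_lintegral]
  refine lt_of_le_of_lt (lintegral_mono_set hsub) ?_
  have hcv := Complex.volume_preserving_equiv_real_prod.setLIntegral_comp_preimage_emb
    Complex.measurableEquivRealProd.measurableEmbedding
    (fun x : ℝ × ℝ ↦ ((((1 / ‖x.2‖₊) ^ 2 : NNReal)) : ENNReal))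
    (Set.Icc (-1 : ℝ) 1 ×ˢ Set.Ioi (1 / 2 : ℝ))
  refine lt_of_le_of_lt (le_of_eq hcv) ?_
  rw [Measure.volume_eq_prod, ← Measure.prod_restrict]
  refine lt_of_le_of_lt (lintegral_prod_le _) ?_
  dsimp only
  rw [lintegral_const, Measure.restrict_apply_univ, Real.volume_Icc]
  exact ENNReal.mul_lt_top hfin ENNReal.ofReal_lt_top

theorem peterssonInner_integrable {M : ℕ} [NeZero M] {k : ℤ} (f g : CuspSpace M k)
    (γ : SL(2, ℤ)) : IntegrableOn (fun z : ℍ ↦ petersson k f g (γ • z)) 𝒟 := by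
  obtain ⟨C, hC⟩ := CuspFormClass.petersson_bounded_left k
    ((Gamma0 M : Subgroup SL(2, ℤ)) : Subgroup (GL (Fin 2) ℝ)) f g
  refine IntegrableOn.of_bound volume_fd_lt_top ?_ C (ae_of_all _ fun z ↦ hC _)
  refine Continuous.aestronglyMeasurable ?_
  refine (petersson_continuous k ?_ ?_).comp
    (continuous_const_smul (Matrix.SpecialLinearGroup.mapGL ℝ γ))
  · exact (CuspFormClass.holo f).continuous
  · exact (CuspFormClass.holo g).continuous

theorem peterssonInner_add_right {M : ℕ} [NeZero M] {k : ℤ} (f g₁ g₂ : CuspSpace M k) :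
    peterssonInner f (g₁ + g₂) = peterssonInner f g₁ + peterssonInner f g₂ := by
  unfold peterssonInner
  rw [← finsum_add_distrib (Set.toFinite _) (Set.toFinite _)]
  refine finsum_congr fun q ↦ ?_
  rw [← integral_add (peterssonInner_integrable f g₁ _) (peterssonInner_integrable f g₂ _)]
  refine integral_congr_ae (ae_of_all _ fun z ↦ ?_)
  simp only [petersson, FunLike.coe_add, Pi.add_apply]
  ring

theorem peterssonInner_smul_right {M : ℕ} {k : ℤ} (c : ℂ) (f g : CuspSpace M k) :
    peterssonInner f (c • g) = c * peterssonInner f g := by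
  unfold peterssonInner
  rw [← smul_eq_mul, smul_finsum]
  refine finsum_congr fun q ↦ ?_
  rw [smul_eq_mul, ← integral_const_mul]
  refine integral_congr_ae (ae_of_all _ fun z ↦ ?_)
  simp only [petersson, FunLike.coe_smul, Pi.smul_apply, smul_eq_mul]
  ring

/-! ### Oldforms and newforms at `p` -/

/-- The point `p z` of the upper half-plane. -/
noncomputable def mulPoint (p : ℕ) [Fact p.Prime] (z : ℍ) : ℍ :=
  ⟨(p : ℂ) * z, by
    have hp : (0 : ℝ) < p := by exact_mod_cast (Fact.out : p.Prime).pos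
    simpa using mul_pos hp z.im_pos⟩

/-- The `p`-old subspace of `S_k(Γ₀(p * N))`: the span of the forms `g(z)` and `g(p z)` with
`g ∈ S_k(Γ₀(N))`. -/
noncomputable def pOld (p N : ℕ) [Fact p.Prime] (k : ℤ) : Submodule ℂ (CuspSpace (p * N) k) :=
  Submodule.span ℂ {f | ∃ g : CuspSpace N k, (∀ z, f z = g z) ∨ (∀ z, f z = g (mulPoint p z))}

/-- The `p`-new subspace of `S_k(Γ₀(p * N))`: the orthogonal complement of the `p`-old subspace
for the Petersson inner product. -/
noncomputable def pNew (p N : ℕ) [Fact p.Prime] [NeZero N] (k : ℤ) :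
    Submodule ℂ (CuspSpace (p * N) k) where
  carrier := {f | ∀ g ∈ pOld p N k, peterssonInner g f = 0}
  add_mem' := by
    intro f₁ f₂ h₁ h₂ g hg
    have : NeZero p := ⟨(Fact.out : p.Prime).ne_zero⟩
    rw [peterssonInner_add_right, h₁ g hg, h₂ g hg, add_zero]
  zero_mem' := by
    intro g _
    simpa using peterssonInner_smul_right (0 : ℂ) g (0 : CuspSpace (p * N) k)
  smul_mem' := by
    intro r f hf g hg
    rw [peterssonInner_smul_right, hf g hg, mul_zero]

/-! ### Finite dimensionality -/

section FiniteDimensionality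

open Filter Asymptotics Topology

/-! `W_p` swaps the spaces of forms `g(z)` and `g(pz)`: with `w` the Atkin-Lehner matrix and `A =
diag(p, 1)`, both `w * A⁻¹` and `p⁻¹ * A * w` lie in `Γ₀(N)`. If the two spaces are independent,
`W_p` is block off-diagonal on their sum, so its trace there is zero.

Independence (`disjoint_oldForms_scaledOldForms`) needs no theory of `q`-expansions: for `f` in both
spaces, `|f|² y^k` is invariant under `Γ₀(N)` and under its conjugate by `A`. Together these
contain, up to scalars, a map `z ↦ p² z + u`; its iterates push any point to the cusp `i∞`, where
`|f|² y^k` tends to `0`.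

For the new space, `W_p` preserves the Petersson product because `w` normalises `Γ₀(pN)` and so
carries one fundamental domain to another (`peterssonInner_atkinLehner`). As `W_p² = 1` on old
forms, the orthogonal complement is stable. Positivity of the product and finite dimension make it a
true complement (`isCompl_pNew_pOld`), so the traces add. Finite dimension comes from a Sturm bound,
obtained by taking norms down to level one. -/

theorem natCast_le_analyticOrderAt_of_isBigO {f : ℂ → ℂ} {n : ℕ} (hf : AnalyticAt ℂ f 0)
    (h : f =O[𝓝[≠] 0] fun z ↦ z ^ n) : (n : ℕ∞) ≤ analyticOrderAt f 0 := by
  by_contra! hlt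
  obtain ⟨m, hm⟩ := ENat.ne_top_iff_exists.mp hlt.ne_top
  rw [← hm, Nat.cast_lt] at hlt
  obtain ⟨g, hg, hg0, hfg⟩ := (hf.analyticOrderAt_eq_natCast).mp hm.symm
  apply hg0
  have h1 : g =O[𝓝[≠] 0] fun z : ℂ ↦ z ^ (n - m) := by
    obtain ⟨C, hC⟩ := h.bound
    refine IsBigO.of_bound C ?_
    filter_upwards [hC, hfg.filter_mono nhdsWithin_le_nhds, self_mem_nhdsWithin] with z h1 h2 h3
    have hz : 0 < ‖z ^ m‖ := norm_pos_iff.mpr (pow_ne_zero _ h3)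
    rw [h2, sub_zero, smul_eq_mul, norm_mul, ← Nat.sub_add_cancel hlt.le, pow_add, norm_mul] at h1
    refine le_of_mul_le_mul_left (h1.trans_eq ?_) hz
    ring
  have h2 : Tendsto (fun z : ℂ ↦ z ^ (n - m)) (𝓝[≠] 0) (𝓝 0) := by
    have : Tendsto (fun z : ℂ ↦ z ^ (n - m)) (𝓝 0) (𝓝 (0 ^ (n - m))) :=
      (continuous_pow (n - m)).tendsto 0
    rw [zero_pow (Nat.sub_ne_zero_of_lt hlt)] at this
    exact this.mono_left nhdsWithin_le_nhds
  exact tendsto_nhds_unique (hg.continuousAt.tendsto.mono_left nhdsWithin_le_nhds)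
    (h1.trans_tendsto h2)

theorem isBigO_pow_of_natCast_le_analyticOrderAt {f : ℂ → ℂ} {n : ℕ} (hf : AnalyticAt ℂ f 0)
    (h : (n : ℕ∞) ≤ analyticOrderAt f 0) : f =O[𝓝 0] fun z ↦ z ^ n := by
  obtain ⟨g, hg, hfg⟩ := (natCast_le_analyticOrderAt hf).mp h
  have h1 : (fun z : ℂ ↦ z ^ n * g z) =O[𝓝 0] fun z ↦ z ^ n * 1 :=
    (isBigO_refl _ _).mul (hg.continuousAt.tendsto.isBigO_one ℂ)
  simp only [mul_one] at h1
  refine h1.congr' ?_ .rfl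
  filter_upwards [hfg] with z hz
  rw [hz, sub_zero, smul_eq_mul]

theorem natCast_le_order_qExpansion_iff {f : ℍ → ℂ} {h : ℝ} {n : ℕ}
    (hF : AnalyticAt ℂ (cuspFunction h f) 0) :
    (n : ℕ∞) ≤ (qExpansion h f).order ↔ (n : ℕ∞) ≤ analyticOrderAt (cuspFunction h f) 0 := by
  rw [natCast_le_analyticOrderAt_iff_iteratedDeriv_eq_zero hF]
  constructor
  · intro H i hi
    have := PowerSeries.coeff_of_lt_order i (lt_of_lt_of_le (by exact_mod_cast hi) H)
    simpa [qExpansion_coeff, Nat.factorial_ne_zero] using this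
  · intro H
    refine PowerSeries.nat_le_order _ _ fun i hi ↦ ?_
    rw [qExpansion_coeff, H i hi, mul_zero]

/-- Growth at `i∞`, unlike the order of a `q`-expansion, makes sense for the individual factors of a
norm, which need not have period `1`. -/
theorem isBigO_qParam_pow_iff {f : ℍ → ℂ} {h : ℝ} (hh : 0 < h) {n : ℕ}
    (hfper : Function.Periodic (f ∘ ofComplex) h)
    (hF : AnalyticAt ℂ (cuspFunction h f) 0) :
    f =O[atImInfty] (fun τ ↦ Function.Periodic.qParam h τ ^ n) ↔
      (n : ℕ∞) ≤ (qExpansion h f).order := by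
  rw [natCast_le_order_qExpansion_iff hF]
  constructor
  · intro H
    refine natCast_le_analyticOrderAt_of_isBigO hF ?_
    have ht : Tendsto (fun q ↦ ofComplex (Function.Periodic.invQParam h q)) (𝓝[≠] 0) atImInfty :=
      tendsto_comap_im_ofComplex.comp (Function.Periodic.invQParam_tendsto hh)
    refine (H.comp_tendsto ht).congr' ?_ ?_
    · filter_upwards [self_mem_nhdsWithin] with q hq
      exact (Function.Periodic.cuspFunction_eq_of_nonzero h (f ∘ ofComplex) hq).symm
    · filter_upwards [self_mem_nhdsWithin,
        (Function.Periodic.invQParam_tendsto hh).eventually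
          (preimage_mem_comap (Ioi_mem_atTop (0 : ℝ)))] with q hq hq'
      have : ((ofComplex (Function.Periodic.invQParam h q) : ℍ) : ℂ) =
          Function.Periodic.invQParam h q := ofComplex_apply_of_im_pos hq' ▸ rfl
      simp only [Function.comp_apply, this]
      rw [Function.Periodic.qParam_right_inv hh.ne' hq]
  · intro H
    refine ((isBigO_pow_of_natCast_le_analyticOrderAt hF H).comp_tendsto
      (qParam_tendsto_atImInfty hh)).congr_left fun τ ↦ ?_
    exact eq_cuspFunction τ hh.ne' hfper

variable {M : ℕ} {k : ℤ}

theorem one_mem_strictPeriods_Gamma0 (M : ℕ) :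
    (1 : ℝ) ∈ ((Gamma0 M : Subgroup SL(2, ℤ)) : Subgroup (GL (Fin 2) ℝ)).strictPeriods := by
  rw [Subgroup.strictPeriods_eq_zmultiples_one_of_T_mem]
  · exact AddSubgroup.mem_zmultiples 1
  · rw [Gamma0_mem]
    simp [ModularGroup.T]

/-- The norm is a product over cosets: the trivial coset contributes `f`, and every other factor is
a slash of `f`, hence bounded at `i∞`. -/
theorem isBigO_norm_of_isBigO [NeZero M] (f : CuspSpace M k) {g : ℍ → ℂ}
    (hf : ⇑f =O[atImInfty] g) : ⇑(ModularForm.norm 𝒮ℒ f) =O[atImInfty] g := by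
  classical
  let _ := Fintype.ofFinite
    (𝒮ℒ ⧸ (((Gamma0 M : Subgroup SL(2, ℤ)) : Subgroup (GL (Fin 2) ℝ)).subgroupOf 𝒮ℒ))
  let q₀ : 𝒮ℒ ⧸ (((Gamma0 M : Subgroup SL(2, ℤ)) : Subgroup (GL (Fin 2) ℝ)).subgroupOf 𝒮ℒ) :=
    QuotientGroup.mk 1
  have h0 : ⇑(ModularForm.norm 𝒮ℒ f) = SlashInvariantForm.quotientFunc f q₀ *
      ∏ q ∈ Finset.univ.erase q₀, SlashInvariantForm.quotientFunc f q :=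
    (Finset.mul_prod_erase _ _ (Finset.mem_univ _)).symm
  have h1 : SlashInvariantForm.quotientFunc f q₀ =O[atImInfty] g := by
    have : SlashInvariantForm.quotientFunc f q₀ = f := by
      refine (SlashInvariantForm.quotientFunc_mk f 1).trans ?_
      simp
    rwa [this]
  have h2 : (∏ q ∈ Finset.univ.erase q₀, SlashInvariantForm.quotientFunc f q)
      =O[atImInfty] fun _ ↦ ∏ q ∈ Finset.univ.erase q₀, (1 : ℂ) := by
    rw [Finset.prod_fn]
    refine .finsetProd fun q _ ↦ ?_
    induction q using QuotientGroup.induction_on with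
    | H r =>
      obtain ⟨_, s, rfl⟩ := r
      have := ModularFormClass.bdd_at_infty_slash f s⁻¹
      rw [ModularForm.SL_slash, map_inv] at this
      exact this.trans (isBigO_of_le _ fun _ ↦ by simp)
  rw [h0]
  exact (h1.mul h2).congr (fun _ ↦ rfl) fun _ ↦ by simp

/-- The norm of `f` has level one and weight `k` times the index, and vanishes at `i∞` to order at
least `n`. The level-one Sturm bound kills it, and a zero norm forces `f = 0`. -/
theorem CuspSpace.eq_zero_of_le_order_qExpansion [NeZero M] (f : CuspSpace M k) {n : ℕ}
    (hn : (k * Nat.card (𝒮ℒ ⧸ (((Gamma0 M : Subgroup SL(2, ℤ)) :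
      Subgroup (GL (Fin 2) ℝ)).subgroupOf 𝒮ℒ))).toNat / 12 < n)
    (h : (n : ℕ∞) ≤ (qExpansion 1 f).order) : f = 0 := by
  have hΓ := one_mem_strictPeriods_Gamma0 M
  have h1 : ⇑f =O[atImInfty] (fun τ ↦ Function.Periodic.qParam 1 τ ^ n) :=
    (isBigO_qParam_pow_iff one_pos (SlashInvariantFormClass.periodic_comp_ofComplex f hΓ)
      (ModularFormClass.analyticAt_cuspFunction_zero f one_pos hΓ)).mpr h
  have hSL : (1 : ℝ) ∈ Subgroup.strictPeriods 𝒮ℒ := by simp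
  have h2 := (isBigO_qParam_pow_iff one_pos
    (SlashInvariantFormClass.periodic_comp_ofComplex (ModularForm.norm 𝒮ℒ f) hSL)
    (ModularFormClass.analyticAt_cuspFunction_zero (ModularForm.norm 𝒮ℒ f) one_pos hSL)).mp
    (isBigO_norm_of_isBigO f h1)
  have h3 : ModularForm.norm 𝒮ℒ f = 0 :=
    ModularForm.sturm_bound_levelOne (lt_of_lt_of_le (by exact_mod_cast hn) h2)
  rw [ModularForm.norm_eq_zero_iff] at h3
  exact DFunLike.coe_injective h3

/-- The first `n` coefficients of the `q`-expansion of a cusp form. -/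
noncomputable def CuspSpace.qCoeffs (M : ℕ) (k : ℤ) (n : ℕ) [NeZero M] :
    CuspSpace M k →ₗ[ℂ] (Fin n → ℂ) where
  toFun f i := (qExpansion 1 f).coeff i
  map_add' f g := by
    have hΓ := one_mem_strictPeriods_Gamma0 M
    ext i
    rw [FunLike.coe_add, qExpansion_add (ModularFormClass.analyticAt_cuspFunction_zero f one_pos hΓ)
      (ModularFormClass.analyticAt_cuspFunction_zero g one_pos hΓ)]
    simp
  map_smul' r f := by
    have hΓ := one_mem_strictPeriods_Gamma0 M
    ext i
    rw [FunLike.coe_smul,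
      qExpansion_smul (ModularFormClass.analyticAt_cuspFunction_zero f one_pos hΓ)]
    simp

theorem CuspSpace.finiteDimensional (M : ℕ) [NeZero M] (k : ℤ) :
    FiniteDimensional ℂ (CuspSpace M k) := by
  set n := (k * Nat.card (𝒮ℒ ⧸ (((Gamma0 M : Subgroup SL(2, ℤ)) :
      Subgroup (GL (Fin 2) ℝ)).subgroupOf 𝒮ℒ))).toNat / 12 + 1 with hn
  refine FiniteDimensional.of_injective (CuspSpace.qCoeffs M k n) ?_
  rw [injective_iff_map_eq_zero]
  intro f hf
  refine f.eq_zero_of_le_order_qExpansion (n := n) (by omega) ?_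
  exact PowerSeries.nat_le_order _ _ fun i hi ↦ congrFun hf ⟨i, hi⟩

end FiniteDimensionality

/-! ### The Atkin-Lehner operator exchanges the two spaces of oldforms -/

section Oldforms

variable {p N : ℕ} [Fact p.Prime] {k : ℤ}

/-- The forms `g(z)` of level `p * N`, for `g` of level `N`. -/
def oldForms (p N : ℕ) (k : ℤ) : Submodule ℂ (CuspSpace (p * N) k) where
  carrier := {f | ∃ g : CuspSpace N k, ∀ z, f z = g z}
  add_mem' := by
    rintro f₁ f₂ ⟨g₁, h₁⟩ ⟨g₂, h₂⟩
    exact ⟨g₁ + g₂, fun z ↦ by simp [h₁, h₂]⟩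
  zero_mem' := ⟨0, fun z ↦ by simp⟩
  smul_mem' := by
    rintro r f ⟨g, h⟩
    exact ⟨r • g, fun z ↦ by simp [h]⟩

/-- The forms `g(p z)` of level `p * N`, for `g` of level `N`. -/
noncomputable def scaledOldForms (p N : ℕ) [Fact p.Prime] (k : ℤ) :
    Submodule ℂ (CuspSpace (p * N) k) where
  carrier := {f | ∃ g : CuspSpace N k, ∀ z, f z = g (mulPoint p z)}
  add_mem' := by
    rintro f₁ f₂ ⟨g₁, h₁⟩ ⟨g₂, h₂⟩
    exact ⟨g₁ + g₂, fun z ↦ by simp [h₁, h₂]⟩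
  zero_mem' := ⟨0, fun z ↦ by simp⟩
  smul_mem' := by
    rintro r f ⟨g, h⟩
    exact ⟨r • g, fun z ↦ by simp [h]⟩

theorem pOld_eq_sup (p N : ℕ) [Fact p.Prime] (k : ℤ) :
    pOld p N k = oldForms p N k ⊔ scaledOldForms p N k := by
  rw [← Submodule.span_eq (oldForms p N k), ← Submodule.span_eq (scaledOldForms p N k),
    ← Submodule.span_union, pOld]
  congr 1
  ext f
  exact exists_or

/-- The matrix `diag(p, 1)`. -/
noncomputable def scaleMatrix (p : ℕ) [Fact p.Prime] : GL (Fin 2) ℝ :=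
  Matrix.GeneralLinearGroup.mkOfDetNeZero !![(p : ℝ), 0; 0, 1] (by
    simpa [Matrix.det_fin_two_of] using (Fact.out : p.Prime).ne_zero)

theorem natCast_pos_of_fact_prime (p : ℕ) [Fact p.Prime] : (0 : ℝ) < p := by
  exact_mod_cast (Fact.out : p.Prime).pos

theorem scaleMatrix_det (p : ℕ) [Fact p.Prime] : (scaleMatrix p).det.val = p := by
  change Matrix.det !![(p : ℝ), 0; 0, 1] = p
  rw [Matrix.det_fin_two_of]
  ring

theorem scaleMatrix_smul (p : ℕ) [Fact p.Prime] (z : ℍ) : scaleMatrix p • z = mulPoint p z := by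
  ext
  rw [coe_smul_of_det_pos (by rw [scaleMatrix_det]; exact natCast_pos_of_fact_prime p)]
  simp [num, denom, scaleMatrix, mulPoint, Matrix.GeneralLinearGroup.mkOfDetNeZero]

theorem slash_scaleMatrix_apply (p : ℕ) [Fact p.Prime] (k : ℤ) (f : ℍ → ℂ) (z : ℍ) :
    (f ∣[k] scaleMatrix p) z = (p : ℂ) ^ (k - 1) * f (mulPoint p z) := by
  have hp := natCast_pos_of_fact_prime p
  have hd : denom (scaleMatrix p) z = 1 := by
    simp [denom, scaleMatrix, Matrix.GeneralLinearGroup.mkOfDetNeZero]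
  rw [ModularForm.slash_def]
  beta_reduce
  rw [scaleMatrix_smul, hd, scaleMatrix_det, abs_of_pos hp, σ, if_pos]
  · simp [mul_comm]
  · rw [scaleMatrix_det]; exact hp

theorem slash_scalar_apply (k : ℤ) (u : ℝˣ) (f : ℍ → ℂ) (z : ℍ) :
    (f ∣[k] Matrix.GeneralLinearGroup.scalar (Fin 2) u) z = (u : ℂ) ^ (k - 2) * f z := by
  have hu : ((u : ℝ) : ℂ) ≠ 0 := by exact_mod_cast u.ne_zero
  have hdet : (Matrix.GeneralLinearGroup.scalar (Fin 2) u).det.val = (u : ℝ) ^ 2 := by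
    simp
  have hpos : 0 < (u : ℝ) ^ 2 := sq_pos_of_ne_zero u.ne_zero
  rw [ModularForm.slash_def]
  beta_reduce
  rw [glScalar_smul, denom_scalar, hdet, abs_of_pos hpos, σ,
    if_pos (by rw [hdet]; exact hpos)]
  simp only [ContinuousAlgEquiv.refl_apply, Complex.ofReal_pow]
  rw [← zpow_natCast, ← zpow_mul, mul_assoc, ← zpow_add₀ hu, mul_comm]
  congr 2
  push_cast
  ring

/-- An integral matrix with lower left entry divisible by `M`, as an element of `Γ₀(M)`. -/
theorem exists_mem_Gamma0 (M : ℕ) (α β γ δ : ℤ) (h : α * δ - M * β * γ = 1) :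
    ∃ g ∈ Gamma0 M, (g : Matrix (Fin 2) (Fin 2) ℤ) = !![α, β; M * γ, δ] := by
  let g : SL(2, ℤ) := ⟨!![α, β; M * γ, δ], by
    rw [Matrix.det_fin_two_of]
    linear_combination h⟩
  refine ⟨g, ?_, rfl⟩
  rw [Gamma0_mem]
  change ((M * γ : ℤ) : ZMod M) = 0
  simp

theorem CuspSpace.slash_mapGL {M : ℕ} (f : CuspSpace M k) {g : SL(2, ℤ)} (hg : g ∈ Gamma0 M) :
    ⇑f ∣[k] (Matrix.SpecialLinearGroup.mapGL ℝ g) = f :=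
  SlashInvariantFormClass.slash_action_eq f _ (Subgroup.mem_map_of_mem _ hg)

variable {a b c d : ℤ} (h : (p : ℤ) * a * d - N * b * c = 1)

theorem coe_atkinLehnerMatrix :
    (atkinLehnerMatrix p N a b c d h : Matrix (Fin 2) (Fin 2) ℝ) =
      !![(p : ℝ) * a, (b : ℝ); (p : ℝ) * N * c, (p : ℝ) * d] := rfl

theorem coe_scaleMatrix : (scaleMatrix p : Matrix (Fin 2) (Fin 2) ℝ) = !![(p : ℝ), 0; 0, 1] := rfl

theorem coe_mapGL_of_eq {g : SL(2, ℤ)} {α β γ δ : ℤ}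
    (hg : (g : Matrix (Fin 2) (Fin 2) ℤ) = !![α, β; γ, δ]) :
    (Matrix.SpecialLinearGroup.mapGL ℝ g : Matrix (Fin 2) (Fin 2) ℝ) =
      !![(α : ℝ), (β : ℝ); (γ : ℝ), (δ : ℝ)] := by
  ext i j
  have : Matrix.SpecialLinearGroup.mapGL ℝ g i j = ((g i j : ℤ) : ℝ) := rfl
  rw [this, hg]
  fin_cases i <;> fin_cases j <;> rfl

theorem coe_scalar_units (u : ℝˣ) :
    (Matrix.GeneralLinearGroup.scalar (Fin 2) u : Matrix (Fin 2) (Fin 2) ℝ) =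
      !![(u : ℝ), 0; 0, (u : ℝ)] := by
  ext i j
  fin_cases i <;> fin_cases j <;> rfl

/-- Dividing the first column of `w` by `p` leaves `(a, b; N c, p d)`, of determinant `1`. -/
theorem exists_atkinLehnerMatrix_eq_mul_scaleMatrix :
    ∃ g ∈ Gamma0 N, atkinLehnerMatrix p N a b c d h =
      Matrix.SpecialLinearGroup.mapGL ℝ g * scaleMatrix p := by
  obtain ⟨g, hg, hg'⟩ := exists_mem_Gamma0 N a b c (p * d) (by linear_combination h)
  refine ⟨g, hg, ?_⟩
  apply Units.ext
  rw [Units.val_mul, coe_mapGL_of_eq hg', coe_scaleMatrix, coe_atkinLehnerMatrix]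
  ext i j
  fin_cases i <;> fin_cases j <;> simp [Matrix.mul_apply, Fin.sum_univ_two] <;> ring

/-- Multiplying the first row of `w` by `p` makes every entry divisible by `p`; the quotient `(p a,
b; N c, d)` has determinant `1`. -/
theorem exists_scaleMatrix_mul_atkinLehnerMatrix_eq :
    ∃ g ∈ Gamma0 N, scaleMatrix p * atkinLehnerMatrix p N a b c d h =
      Matrix.SpecialLinearGroup.mapGL ℝ g * Matrix.GeneralLinearGroup.scalar (Fin 2)
        (Units.mk0 (p : ℝ) (natCast_pos_of_fact_prime p).ne') := by
  obtain ⟨g, hg, hg'⟩ := exists_mem_Gamma0 N (p * a) b c d (by linear_combination h)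
  refine ⟨g, hg, ?_⟩
  apply Units.ext
  rw [Units.val_mul, Units.val_mul, coe_mapGL_of_eq hg', coe_scaleMatrix, coe_atkinLehnerMatrix,
    coe_scalar_units]
  ext i j
  fin_cases i <;> fin_cases j <;> simp [Matrix.mul_apply, Fin.sum_univ_two] <;> ring

theorem atkinLehner_apply (f : CuspSpace (p * N) k) (z : ℍ) :
    atkinLehner p N k a b c d h f z =
      (((p : ℝ) ^ (1 - (k : ℝ) / 2) : ℝ) : ℂ) * (⇑f ∣[k] atkinLehnerMatrix p N a b c d h) z :=
  rfl

theorem atkinLehner_apply_of_eq {f : CuspSpace (p * N) k} {g : CuspSpace N k}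
    (hfg : ∀ z, f z = g z) (z : ℍ) :
    atkinLehner p N k a b c d h f z =
      (((p : ℝ) ^ (1 - (k : ℝ) / 2) : ℝ) : ℂ) * (p : ℂ) ^ (k - 1) * g (mulPoint p z) := by
  obtain ⟨γ, hγ, hw⟩ := exists_atkinLehnerMatrix_eq_mul_scaleMatrix h
  rw [atkinLehner_apply, hw, show ⇑f = g from funext hfg, SlashAction.slash_mul,
    g.slash_mapGL hγ, slash_scaleMatrix_apply, mul_assoc]

theorem atkinLehner_apply_of_eq_mulPoint {f : CuspSpace (p * N) k} {g : CuspSpace N k}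
    (hfg : ∀ z, f z = g (mulPoint p z)) (z : ℍ) :
    atkinLehner p N k a b c d h f z =
      (((p : ℝ) ^ (1 - (k : ℝ) / 2) : ℝ) : ℂ) * (p : ℂ) ^ (-1 : ℤ) * g z := by
  obtain ⟨γ, hγ, hw⟩ := exists_scaleMatrix_mul_atkinLehnerMatrix_eq h
  have hp : (p : ℂ) ≠ 0 := by exact_mod_cast (Fact.out : p.Prime).ne_zero
  have hf : ⇑f = (p : ℂ) ^ (1 - k) • (⇑g ∣[k] scaleMatrix p) := by
    ext z
    rw [Pi.smul_apply, slash_scaleMatrix_apply, hfg, smul_eq_mul, ← mul_assoc, ← zpow_add₀ hp]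
    simp
  have hd : 0 < (atkinLehnerMatrix p N a b c d h).det.val := by
    rw [atkinLehnerMatrix_det]
    exact natCast_pos_of_fact_prime p
  rw [atkinLehner_apply, hf, ModularForm.smul_slash, ← SlashAction.slash_mul, hw,
    SlashAction.slash_mul, g.slash_mapGL hγ, Pi.smul_apply, slash_scalar_apply, σ, if_pos hd,
    ContinuousAlgEquiv.refl_apply, mul_assoc, smul_eq_mul, ← mul_assoc (_ ^ (1 - k))]
  congr 2
  change (p : ℂ) ^ (1 - k) * (((p : ℝ) : ℂ)) ^ (k - 2) = _
  rw [Complex.ofReal_natCast, ← zpow_add₀ hp]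
  congr 1
  ring

theorem atkinLehner_mem_scaledOldForms {f : CuspSpace (p * N) k} (hf : f ∈ oldForms p N k) :
    atkinLehner p N k a b c d h f ∈ scaledOldForms p N k := by
  obtain ⟨g, hg⟩ := hf
  exact ⟨((((p : ℝ) ^ (1 - (k : ℝ) / 2) : ℝ) : ℂ) * (p : ℂ) ^ (k - 1)) • g,
    fun z ↦ atkinLehner_apply_of_eq h hg z⟩

theorem atkinLehner_mem_oldForms {f : CuspSpace (p * N) k} (hf : f ∈ scaledOldForms p N k) :
    atkinLehner p N k a b c d h f ∈ oldForms p N k := by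
  obtain ⟨g, hg⟩ := hf
  exact ⟨((((p : ℝ) ^ (1 - (k : ℝ) / 2) : ℝ) : ℂ) * (p : ℂ) ^ (-1 : ℤ)) • g,
    fun z ↦ atkinLehner_apply_of_eq_mulPoint h hg z⟩

/-- The factors are the constants picked up in passing from `g(z)` to `g(pz)` and back; their
exponents `k / 2` and `-k / 2` cancel. -/
theorem atkinLehner_const_mul_const (p : ℕ) [Fact p.Prime] (k : ℤ) :
    ((((p : ℝ) ^ (1 - (k : ℝ) / 2) : ℝ) : ℂ) * (p : ℂ) ^ (k - 1)) *
      ((((p : ℝ) ^ (1 - (k : ℝ) / 2) : ℝ) : ℂ) * (p : ℂ) ^ (-1 : ℤ)) = 1 := by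
  have hp := natCast_pos_of_fact_prime p
  have : ((p : ℝ) ^ (1 - (k : ℝ) / 2) * (p : ℝ) ^ (k - 1)) *
      ((p : ℝ) ^ (1 - (k : ℝ) / 2) * (p : ℝ) ^ (-1 : ℤ)) = 1 := by
    rw [← Real.rpow_intCast, ← Real.rpow_intCast, ← Real.rpow_add hp, ← Real.rpow_add hp,
      ← Real.rpow_add hp]
    convert Real.rpow_zero (p : ℝ) using 2
    push_cast
    ring
  have hC := congrArg Complex.ofReal this
  simpa only [Complex.ofReal_mul, Complex.ofReal_zpow, Complex.ofReal_natCast,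
    Complex.ofReal_one] using hC

theorem atkinLehner_atkinLehner_of_mem_pOld {f : CuspSpace (p * N) k} (hf : f ∈ pOld p N k) :
    atkinLehner p N k a b c d h (atkinLehner p N k a b c d h f) = f := by
  rw [pOld_eq_sup] at hf
  obtain ⟨f₁, ⟨g₁, h₁⟩, f₂, ⟨g₂, h₂⟩, rfl⟩ := Submodule.mem_sup.mp hf
  have hc := atkinLehner_const_mul_const p k
  rw [map_add, map_add]
  congr 1
  · ext z
    refine (atkinLehner_apply_of_eq_mulPoint h 
      (g := ((((p : ℝ) ^ (1 - (k : ℝ) / 2) : ℝ) : ℂ) * (p : ℂ) ^ (k - 1)) • g₁)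
      (fun z ↦ atkinLehner_apply_of_eq h h₁ z) z).trans ?_
    rw [h₁]
    change _ * (_ * g₁ z) = _
    linear_combination g₁ z * hc
  · ext z
    refine (atkinLehner_apply_of_eq h 
      (g := ((((p : ℝ) ^ (1 - (k : ℝ) / 2) : ℝ) : ℂ) * (p : ℂ) ^ (-1 : ℤ)) • g₂)
      (fun z ↦ atkinLehner_apply_of_eq_mulPoint h h₂ z) z).trans ?_
    rw [h₂]
    change _ * (_ * g₂ _) = _
    linear_combination g₂ (mulPoint p z) * hc

theorem atkinLehner_mem_pOld {f : CuspSpace (p * N) k} (hf : f ∈ pOld p N k) :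
    atkinLehner p N k a b c d h f ∈ pOld p N k := by
  rw [pOld_eq_sup] at hf ⊢
  obtain ⟨f₁, h₁, f₂, h₂, rfl⟩ := Submodule.mem_sup.mp hf
  rw [map_add, add_comm]
  exact Submodule.add_mem_sup (atkinLehner_mem_oldForms h h₂) (atkinLehner_mem_scaledOldForms h h₁)

end Oldforms

/-! ### The two spaces of oldforms are independent -/

section Independence

open Filter Topology

variable {p N : ℕ} [Fact p.Prime] {k : ℤ}

theorem CuspSpace.petersson_mapGL_smul {M : ℕ} (f g : CuspSpace M k) {γ : SL(2, ℤ)}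
    (hγ : γ ∈ Gamma0 M) (z : ℍ) :
    petersson k f g (Matrix.SpecialLinearGroup.mapGL ℝ γ • z) = petersson k f g z :=
  SlashInvariantFormClass.petersson_smul (Subgroup.mem_map_of_mem _ hγ)

theorem CuspSpace.petersson_isZeroAtImInfty {M : ℕ} [NeZero M] (f g : CuspSpace M k) :
    IsZeroAtImInfty (petersson k f g) :=
  (CuspFormClass.zero_at_infty f).petersson_isZeroAtImInfty_left k
    ((Gamma0 M : Subgroup SL(2, ℤ)) : Subgroup (GL (Fin 2) ℝ)) g

theorem petersson_self_eq_zero_iff {f : ℍ → ℂ} {z : ℍ} : petersson k f f z = 0 ↔ f z = 0 := by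
  have hz : (z.im : ℂ) ≠ 0 := by exact_mod_cast z.im_ne_zero
  simp [petersson, zpow_ne_zero k hz]

theorem petersson_self_mulPoint {f h : ℍ → ℂ} (hfh : ∀ z, f z = h (mulPoint p z)) (z : ℍ) :
    petersson k h h (mulPoint p z) = (p : ℂ) ^ k * petersson k f f z := by
  have : ((mulPoint p z).im : ℂ) = p * z.im := by
    have : (mulPoint p z).im = p * z.im := by
      change ((p : ℂ) * z).im = p * z.im
      simp
    rw [this]
    push_cast
    rfl
  rw [petersson, petersson, hfh, this, mul_zpow]
  ring

/-- The matrix with rows `(p ^ 2, u)` and `(0, 1)`. -/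
noncomputable def dilationMatrix (p : ℕ) [Fact p.Prime] (u : ℤ) : GL (Fin 2) ℝ :=
  Matrix.GeneralLinearGroup.mkOfDetNeZero !![(p : ℝ) ^ 2, (u : ℝ); 0, 1] (by
    simpa [Matrix.det_fin_two_of] using (Fact.out : p.Prime).ne_zero)

theorem dilationMatrix_smul_im (u : ℤ) (z : ℍ) :
    (dilationMatrix p u • z).im = (p : ℝ) ^ 2 * z.im := by
  have hdet : (dilationMatrix p u).det.val = (p : ℝ) ^ 2 := by
    change Matrix.det !![(p : ℝ) ^ 2, (u : ℝ); 0, 1] = _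
    rw [Matrix.det_fin_two_of]
    ring
  rw [im_smul_eq_div_normSq, hdet]
  simp [denom, dilationMatrix, Matrix.GeneralLinearGroup.mkOfDetNeZero]

/-- Up to the scalar `p`, the dilation is `γ₁⁻¹ * (A⁻¹ * γ₂ * A)` with `A = diag(p, 1)`, `γ₁ = (1,
0; N, 1)` and `γ₂ = (p, u; N, v)`. The form `g` gives invariance under `γ₁`, and `h` under the
conjugate of `γ₂`. -/
theorem petersson_self_dilationMatrix_smul {u v : ℤ} (huv : p * v - N * u = 1)
    {f : ℍ → ℂ} {g h : CuspSpace N k} (hg : ∀ z, f z = g z)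
    (hh : ∀ z, f z = h (mulPoint p z)) (z : ℍ) :
    petersson k f f (dilationMatrix p u • z) = petersson k f f z := by
  obtain ⟨γ₁, hγ₁, e₁⟩ := exists_mem_Gamma0 N 1 0 1 1 (by ring)
  obtain ⟨γ₂, hγ₂, e₂⟩ := exists_mem_Gamma0 N p u 1 v (by linear_combination huv)
  have hmat : scaleMatrix p * Matrix.SpecialLinearGroup.mapGL ℝ γ₁ * dilationMatrix p u =
      Matrix.GeneralLinearGroup.scalar (Fin 2)
        (Units.mk0 (p : ℝ) (natCast_pos_of_fact_prime p).ne') *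
      (Matrix.SpecialLinearGroup.mapGL ℝ γ₂ * scaleMatrix p) := by
    have huv' : (p : ℝ) * v - N * u = 1 := by exact_mod_cast huv
    have hd : (dilationMatrix p u : Matrix (Fin 2) (Fin 2) ℝ) =
      !![(p : ℝ) ^ 2, (u : ℝ); 0, 1] := rfl
    apply Units.ext
    simp only [Units.val_mul]
    rw [coe_mapGL_of_eq e₁, coe_mapGL_of_eq e₂, coe_scaleMatrix, coe_scalar_units, hd]
    ext i j
    fin_cases i <;> fin_cases j <;> simp [Matrix.mul_apply, Fin.sum_univ_two]
    · exact .inl (sq _)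
    · ring
    · linear_combination -huv'
  have hpk : (p : ℂ) ^ k ≠ 0 :=
    zpow_ne_zero k (by exact_mod_cast (Fact.out : p.Prime).ne_zero)
  have hfg : f = g := funext hg
  have h₁ : petersson k f f (dilationMatrix p u • z) =
      petersson k f f (Matrix.SpecialLinearGroup.mapGL ℝ γ₁ • dilationMatrix p u • z) := by
    rw [hfg, g.petersson_mapGL_smul g hγ₁]
  rw [h₁]
  -- The factor `p ^ k` turns the Petersson function of `f` at a point into that of `h` at `p` times
  -- the point.
  apply mul_left_cancel₀ hpk
  rw [← petersson_self_mulPoint hh, ← petersson_self_mulPoint hh, ← scaleMatrix_smul,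
    ← scaleMatrix_smul, ← mul_smul, ← mul_smul, hmat, mul_smul, glScalar_smul, mul_smul,
    h.petersson_mapGL_smul h hγ₂]

theorem disjoint_oldForms_scaledOldForms [NeZero N] {a b c d : ℤ}
    (h : (p : ℤ) * a * d - N * b * c = 1) :
    Disjoint (oldForms p N k) (scaledOldForms p N k) := by
  rw [Submodule.disjoint_def]
  rintro f ⟨g₁, h₁⟩ ⟨g₂, h₂⟩
  ext z
  rw [FunLike.coe_zero, Pi.zero_apply, ← petersson_self_eq_zero_iff (k := k)]
  -- The Atkin-Lehner relation itself supplies `u = b * c` and `v = a * d`.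
  set D := dilationMatrix p (b * c) with hD
  have hinv (n : ℕ) : petersson k f f ((fun z ↦ D • z)^[n] z) = petersson k f f z := by
    induction n with
    | zero => rfl
    | succ n ih =>
      rw [Function.iterate_succ_apply', petersson_self_dilationMatrix_smul
        (v := a * d) (by linear_combination h) h₁ h₂, ih]
  have him (n : ℕ) : ((fun z ↦ D • z)^[n] z).im = ((p : ℝ) ^ 2) ^ n * z.im := by
    induction n with
    | zero => simp
    | succ n ih => rw [Function.iterate_succ_apply', dilationMatrix_smul_im, ih]; ring
  have hp : (1 : ℝ) < (p : ℝ) ^ 2 := by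
    have : (1 : ℝ) < p := by exact_mod_cast (Fact.out : p.Prime).one_lt
    nlinarith
  have ht : Tendsto (fun n ↦ (fun z ↦ D • z)^[n] z) atTop atImInfty := by
    rw [atImInfty, tendsto_comap_iff]
    refine ((tendsto_pow_atTop_atTop_of_one_lt hp).atTop_mul_const z.im_pos).congr fun n ↦ ?_
    exact (him n).symm
  have hzero : IsZeroAtImInfty (petersson k f f) := by
    have := g₁.petersson_isZeroAtImInfty g₁
    rwa [← show ⇑f = g₁ from funext h₁] at this
  have hlim := hzero.comp ht
  simp only [Function.comp_def, hinv] at hlim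
  exact tendsto_nhds_unique tendsto_const_nhds hlim

end Independence

/-! ### A fundamental domain for a subgroup of the modular group -/

section FundamentalDomain

theorem volume_setOf_re_eq (c : ℝ) : volume {z : ℂ | z.re = c} = 0 := by
  have : {z : ℂ | z.re = c} = Complex.measurableEquivRealProd ⁻¹' ({c} ×ˢ Set.univ) := by
    ext z
    simp
  rw [this, Complex.volume_preserving_equiv_real_prod.measure_preimage_equiv,
    Measure.volume_eq_prod, Measure.prod_prod]
  simp

theorem volume_fd_diff_fdo : volume (𝒟 \ 𝒟ᵒ : Set ℍ) = 0 := by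
  rw [volume_eq_lintegral]
  refine setLIntegral_measure_zero _ _ (measure_mono_null (t := Metric.sphere 0 1 ∪
    ({z : ℂ | z.re = 1 / 2} ∪ {z : ℂ | z.re = -(1 / 2)})) ?_ ?_)
  · rintro _ ⟨z, ⟨hz, hz'⟩, rfl⟩
    by_cases h1 : 1 < Complex.normSq z
    · right
      have h2 : |z.re| = 1 / 2 :=
        le_antisymm hz.2 (not_lt.mp fun h ↦ hz' ⟨h1, h⟩)
      exact eq_or_eq_neg_of_abs_eq h2
    · left
      have h2 : Complex.normSq z = 1 := le_antisymm (not_lt.mp h1) hz.1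
      rw [mem_sphere_zero_iff_norm, ← sq_eq_sq₀ (norm_nonneg _) zero_le_one,
        ← Complex.normSq_eq_norm_sq, h2, one_pow]
  · rw [measure_union_null_iff, measure_union_null_iff]
    exact ⟨Measure.addHaar_sphere _ _ _, volume_setOf_re_eq _, volume_setOf_re_eq _⟩

instance : MeasurableConstSMul SL(2, ℤ) ℍ :=
  ⟨fun γ ↦ (continuous_const_smul (Matrix.SpecialLinearGroup.mapGL ℝ γ)).measurable⟩

instance : SMulInvariantMeasure SL(2, ℤ) ℍ volume :=
  ⟨fun γ _ hs ↦ SMulInvariantMeasure.measure_preimage_smul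
    (Matrix.SpecialLinearGroup.mapGL ℝ γ) hs⟩

instance : Countable SL(2, ℤ) :=
  have : Countable (Matrix (Fin 2) (Fin 2) ℤ) :=
    inferInstanceAs (Countable (Fin 2 → Fin 2 → ℤ))
  Subtype.coe_injective.countable

/-- The boundary of `𝒟` is null and the group is countable, so a generic point has no translate on
the boundary. -/
theorem ae_smul_mem_fd_imp_mem_fdo :
    ∀ᵐ z : ℍ, ∀ γ : SL(2, ℤ), γ • z ∈ 𝒟 → γ • z ∈ 𝒟ᵒ := by
  rw [ae_all_iff]
  intro γ
  have := (measurePreserving_smul γ (volume : Measure ℍ)).quasiMeasurePreserving.ae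
    (measure_eq_zero_iff_ae_notMem.mp volume_fd_diff_fdo)
  filter_upwards [this] with z hz h1
  by_contra h2
  exact hz ⟨h1, h2⟩

/-- The group of transformations of `ℍ` induced by `Γ`. -/
noncomputable def permImage (Γ : Subgroup SL(2, ℤ)) : Subgroup (Equiv.Perm ℍ) :=
  Γ.map (MulAction.toPermHom SL(2, ℤ) ℍ)

variable {Γ : Subgroup SL(2, ℤ)}

theorem exists_smul_eq_of_mem_permImage (g : permImage Γ) :
    ∃ γ ∈ Γ, ∀ z : ℍ, g • z = γ • z := by
  obtain ⟨_, γ, hγ, rfl⟩ := g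
  exact ⟨γ, hγ, fun _ ↦ rfl⟩

instance : Countable (permImage Γ) :=
  ((Set.to_countable (Γ : Set SL(2, ℤ))).image (MulAction.toPermHom SL(2, ℤ) ℍ)).to_subtype

instance : MeasurableConstSMul (permImage Γ) ℍ where
  measurable_const_smul g := by
    obtain ⟨γ, -, h⟩ := exists_smul_eq_of_mem_permImage g
    rw [show (fun z : ℍ ↦ g • z) = fun z ↦ γ • z from funext h]
    exact measurable_const_smul γ

instance : SMulInvariantMeasure (permImage Γ) ℍ volume where
  measure_preimage_smul g s hs := by
    obtain ⟨γ, -, h⟩ := exists_smul_eq_of_mem_permImage g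
    simp only [h]
    exact SMulInvariantMeasure.measure_preimage_smul γ hs

/-- The union of the translates of the standard fundamental domain by coset representatives. -/
noncomputable def cosetDomain (Γ : Subgroup SL(2, ℤ)) : Set ℍ :=
  ⋃ q : SL(2, ℤ) ⧸ Γ, (q.out⁻¹ : SL(2, ℤ)) • (𝒟 : Set ℍ)

theorem measurableSet_smul_fd (γ : SL(2, ℤ)) : MeasurableSet (γ • (𝒟 : Set ℍ)) :=
  ModularGroup.isClosed_fd.measurableSet.const_smul γ

theorem measurableSet_cosetDomain : MeasurableSet (cosetDomain Γ) :=
  have : Countable (SL(2, ℤ) ⧸ Γ) := QuotientGroup.mk_surjective.countable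
  .iUnion fun _ ↦ measurableSet_smul_fd _

theorem mem_cosetDomain {z : ℍ} :
    z ∈ cosetDomain Γ ↔ ∃ q : SL(2, ℤ) ⧸ Γ, (q.out : SL(2, ℤ)) • z ∈ 𝒟 := by
  simp only [cosetDomain, Set.mem_iUnion, Set.mem_smul_set_iff_inv_smul_mem, inv_inv]

/-- If two elements of the modular group move a generic point into the fundamental domain,
they agree up to sign. -/
theorem eq_or_eq_neg_of_smul_mem_fd {z : ℍ}
    (hz : ∀ γ : SL(2, ℤ), γ • z ∈ 𝒟 → γ • z ∈ 𝒟ᵒ) {γ₁ γ₂ : SL(2, ℤ)}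
    (h₁ : γ₁ • z ∈ 𝒟) (h₂ : γ₂ • z ∈ 𝒟) : γ₂ = γ₁ ∨ γ₂ = -γ₁ := by
  have h₃ : (γ₂ * γ₁⁻¹) • γ₁ • z ∈ 𝒟 := by rwa [smul_smul, inv_mul_cancel_right]
  rcases ModularGroup.eq_one_or_neg_one_of_mem_fdo_mem_fd (hz γ₁ h₁) h₃ with h | h
  · exact .inl (mul_inv_eq_one.mp h)
  · right
    rw [mul_inv_eq_iff_eq_mul.mp h, neg_one_mul]

theorem quotient_eq_of_eq_or_eq_neg (hΓ : -1 ∈ Γ) {q₁ q₂ : SL(2, ℤ) ⧸ Γ} {γ : SL(2, ℤ)}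
    (hγ : γ ∈ Γ) (h : q₂.out * γ = q₁.out ∨ q₂.out * γ = -q₁.out) : q₁ = q₂ := by
  rw [← q₁.out_eq', ← q₂.out_eq']
  symm
  rw [QuotientGroup.eq]
  rcases h with h | h
  · rw [← h, inv_mul_cancel_left]
    exact hγ
  · have : q₁.out = q₂.out * (γ * -1) := by
      rw [← mul_assoc, h]
      simp
    rw [this, inv_mul_cancel_left]
    exact mul_mem hγ hΓ

/-- Since `-1` acts trivially on `ℍ`, disjointness of translates can only hold for the image of `Γ`
in the permutations of `ℍ`. The sign ambiguity for generic points is absorbed by `-1 ∈ Γ`. -/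
theorem isFundamentalDomain_cosetDomain (hΓ : -1 ∈ Γ) :
    IsFundamentalDomain (permImage Γ) (cosetDomain Γ) volume := by
  refine .mk'' measurableSet_cosetDomain.nullMeasurableSet (.of_forall fun z ↦ ?_)
    (fun g hg ↦ ?_) fun g ↦ (measurePreserving_smul g volume).quasiMeasurePreserving
  · obtain ⟨γ, hγ⟩ := ModularGroup.exists_smul_mem_fd z
    -- The chosen representative of the coset of `γ` is `γ * δ`, so it is `δ⁻¹ • z` that lies in the
    -- domain.
    obtain ⟨δ, hδ⟩ := QuotientGroup.mk_out_eq_mul Γ γ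
    refine ⟨⟨_, Subgroup.mem_map_of_mem _ (inv_mem δ.2)⟩, mem_cosetDomain.mpr ⟨γ, ?_⟩⟩
    change (γ : SL(2, ℤ) ⧸ Γ).out • (δ : SL(2, ℤ))⁻¹ • z ∈ 𝒟
    rwa [hδ, smul_smul, mul_inv_cancel_right]
  · obtain ⟨γ, hγ, hgγ⟩ := exists_smul_eq_of_mem_permImage g
    rw [AEDisjoint, measure_eq_zero_iff_ae_notMem]
    filter_upwards [ae_smul_mem_fd_imp_mem_fdo] with z hz
    rintro ⟨⟨y, hy, rfl⟩, hz'⟩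
    simp only [hgγ] at hz hz'
    obtain ⟨q₁, h₁⟩ := mem_cosetDomain.mp hy
    obtain ⟨q₂, h₂⟩ := mem_cosetDomain.mp hz'
    have h₃ : (q₁.out * γ⁻¹) • γ • y ∈ 𝒟 := by rwa [smul_smul, inv_mul_cancel_right]
    have h₄ := eq_or_eq_neg_of_smul_mem_fd hz h₃ h₂
    have h₅ : q₂.out * γ = q₁.out ∨ q₂.out * γ = -q₁.out := by
      rcases h₄ with h | h
      · exact .inl (by rw [h, inv_mul_cancel_right])
      · exact .inr (by rw [h, neg_mul, inv_mul_cancel_right])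
    obtain rfl := quotient_eq_of_eq_or_eq_neg hΓ hγ h₅
    apply hg
    have h₆ : ∀ z : ℍ, γ • z = z := by
      rcases h₅ with h | h
      · rw [mul_eq_left.mp h]
        exact one_smul _
      · have : γ = -1 := by
          rw [← mul_right_inj q₁.out, h]
          simp
        intro z
        rw [this, ModularGroup.SL_neg_smul, one_smul]
    ext z : 2
    exact (hgγ z).trans (h₆ z)

theorem aedisjoint_smul_fd (hΓ : -1 ∈ Γ) :
    Pairwise (Function.onFun (AEDisjoint (volume : Measure ℍ))
      fun q : SL(2, ℤ) ⧸ Γ ↦ (q.out⁻¹ : SL(2, ℤ)) • (𝒟 : Set ℍ)) := by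
  intro q₁ q₂ hq
  rw [Function.onFun, AEDisjoint, measure_eq_zero_iff_ae_notMem]
  filter_upwards [ae_smul_mem_fd_imp_mem_fdo] with z hz
  rintro ⟨h₁, h₂⟩
  rw [Set.mem_smul_set_iff_inv_smul_mem, inv_inv] at h₁ h₂
  refine hq (quotient_eq_of_eq_or_eq_neg hΓ (one_mem Γ) ?_)
  rw [mul_one]
  exact eq_or_eq_neg_of_smul_mem_fd hz h₁ h₂

theorem setIntegral_smul_eq {G : Type*} [Group G] [MulAction G ℍ] [MeasurableConstSMul G ℍ]
    [SMulInvariantMeasure G ℍ volume] (γ : G) (s : Set ℍ) (φ : ℍ → ℂ) :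
    ∫ z in s, φ (γ • z) = ∫ z in γ • s, φ z :=
  ((measurePreserving_smul γ (volume : Measure ℍ)).setIntegral_image_emb
    (measurableEmbedding_const_smul γ) φ s).symm

end FundamentalDomain

/-! ### The Atkin-Lehner operator preserves the Petersson inner product -/

section Unitary

theorem neg_one_mem_Gamma0 (M : ℕ) : -1 ∈ Gamma0 M := by
  rw [Gamma0_mem]
  simp

variable {k : ℤ}

theorem integrableOn_cosetDomain_petersson {M : ℕ} [NeZero M] (f g : CuspSpace M k) :
    IntegrableOn (petersson k f g) (cosetDomain (Gamma0 M)) := by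
  rw [cosetDomain, integrableOn_finite_iUnion]
  intro q
  have := (measurePreserving_smul (q.out⁻¹ : SL(2, ℤ)) (volume : Measure ℍ)).integrableOn_image
    (measurableEmbedding_const_smul _) (f := petersson k f g) (s := 𝒟)
  exact this.mpr (peterssonInner_integrable f g _)

theorem peterssonInner_eq_setIntegral {M : ℕ} [NeZero M] (f g : CuspSpace M k) :
    peterssonInner f g = ∫ z in cosetDomain (Gamma0 M), petersson k f g z := by
  rw [peterssonInner, cosetDomain, integral_iUnion_ae
    (fun q ↦ (measurableSet_smul_fd _).nullMeasurableSet)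
    (aedisjoint_smul_fd (neg_one_mem_Gamma0 M)) (integrableOn_cosetDomain_petersson f g)]
  have := Fintype.ofFinite (SL(2, ℤ) ⧸ Gamma0 M)
  rw [tsum_fintype, finsum_eq_sum_of_fintype]
  exact Finset.sum_congr rfl fun q _ ↦ setIntegral_smul_eq _ _ _

variable {p N : ℕ} [Fact p.Prime] {a b c d : ℤ} (h : (p : ℤ) * a * d - N * b * c = 1)

omit [Fact p.Prime] in
include h in
theorem atkinLehner_entries_adjugate : (p : ℤ) * d * a - N * (-b) * (-c) = 1 := by
  linear_combination h

/-- The adjugate of `w` is again an Atkin-Lehner matrix, so `w⁻¹` acts on `ℍ` as one; this gives the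
other inclusion in `w` normalising `Γ₀(pN)`. -/
theorem atkinLehnerMatrix_mul_adjugate :
    atkinLehnerMatrix p N a b c d h *
      atkinLehnerMatrix p N d (-b) (-c) a (atkinLehner_entries_adjugate h) =
    Matrix.GeneralLinearGroup.scalar (Fin 2)
      (Units.mk0 (p : ℝ) (natCast_pos_of_fact_prime p).ne') := by
  have hR : (p : ℝ) * a * d - N * b * c = 1 := by exact_mod_cast h
  apply Units.ext
  rw [Units.val_mul, coe_atkinLehnerMatrix, coe_atkinLehnerMatrix, coe_scalar_units]
  ext i j
  fin_cases i <;> fin_cases j <;> simp [Matrix.mul_apply, Fin.sum_univ_two]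
  · linear_combination (p : ℝ) * hR
  · ring
  · ring
  · linear_combination (p : ℝ) * hR

theorem toPerm_atkinLehnerMatrix_inv :
    (MulAction.toPerm (atkinLehnerMatrix p N a b c d h) : Equiv.Perm ℍ)⁻¹ =
      MulAction.toPerm
        (atkinLehnerMatrix p N d (-b) (-c) a (atkinLehner_entries_adjugate h)) := by
  rw [inv_eq_iff_mul_eq_one]
  ext z : 1
  change atkinLehnerMatrix p N a b c d h • atkinLehnerMatrix p N d (-b) (-c) a _ • z = z
  rw [smul_smul, atkinLehnerMatrix_mul_adjugate, glScalar_smul]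

theorem conj_toPerm_atkinLehnerMatrix_mem {g : Equiv.Perm ℍ}
    (hg : g ∈ permImage (Gamma0 (p * N))) :
    MulAction.toPerm (atkinLehnerMatrix p N a b c d h) * g *
      (MulAction.toPerm (atkinLehnerMatrix p N a b c d h))⁻¹ ∈ permImage (Gamma0 (p * N)) := by
  obtain ⟨γ, hγ, rfl⟩ := hg
  have := Gamma0_le_conj_atkinLehnerMatrix p N a b c d h (Subgroup.mem_map_of_mem _ hγ)
  rw [Subgroup.mem_pointwise_smul_iff_inv_smul_mem, ← map_inv, inv_inv,
    ConjAct.toConjAct_smul] at this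
  obtain ⟨γ₁, hγ₁, hw⟩ := this
  refine ⟨γ₁, hγ₁, ?_⟩
  rw [eq_mul_inv_iff_mul_eq]
  ext z : 1
  change Matrix.SpecialLinearGroup.mapGL ℝ γ₁ • atkinLehnerMatrix p N a b c d h • z =
    atkinLehnerMatrix p N a b c d h • Matrix.SpecialLinearGroup.mapGL ℝ γ • z
  rw [smul_smul, smul_smul, hw, inv_mul_cancel_right]

theorem isFundamentalDomain_atkinLehnerMatrix_smul :
    IsFundamentalDomain (permImage (Gamma0 (p * N)))
      (atkinLehnerMatrix p N a b c d h • cosetDomain (Gamma0 (p * N))) volume := by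
  set W : Equiv.Perm ℍ := MulAction.toPerm (atkinLehnerMatrix p N a b c d h) with hW
  refine (isFundamentalDomain_cosetDomain (neg_one_mem_Gamma0 _)).image_of_equiv W
    (measurePreserving_smul (atkinLehnerMatrix p N a b c d h)⁻¹ volume).quasiMeasurePreserving
    { toFun := fun g ↦ ⟨W⁻¹ * g * W, ?_⟩
      invFun := fun g ↦ ⟨W * g * W⁻¹, conj_toPerm_atkinLehnerMatrix_mem h g.2⟩
      left_inv := fun g ↦ Subtype.ext (by simp [mul_assoc])
      right_inv := fun g ↦ Subtype.ext (by simp [mul_assoc]) } fun g z ↦ ?_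
  · have := conj_toPerm_atkinLehnerMatrix_mem (atkinLehner_entries_adjugate h) g.2
    rwa [← toPerm_atkinLehnerMatrix_inv h, inv_inv] at this
  · change W (W⁻¹ ((g : Equiv.Perm ℍ) (W z))) = (g : Equiv.Perm ℍ) (W z)
    simp

/-- The normalisation `p ^ (1 - k / 2)`, used once in each argument, cancels the `p ^ (k - 2)` from
slashing. -/
theorem petersson_atkinLehner (f g : CuspSpace (p * N) k) (z : ℍ) :
    petersson k (atkinLehner p N k a b c d h f) (atkinLehner p N k a b c d h g) z =
      petersson k f g (atkinLehnerMatrix p N a b c d h • z) := by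
  have hp := natCast_pos_of_fact_prime p
  have hs := petersson_slash k f g (atkinLehnerMatrix p N a b c d h) z
  rw [atkinLehnerMatrix_det, abs_of_pos hp, σ,
    if_pos (by rw [atkinLehnerMatrix_det]; exact hp), ContinuousAlgEquiv.refl_apply] at hs
  have hc : ((((p : ℝ) ^ (1 - (k : ℝ) / 2) : ℝ) : ℂ) * (((p : ℝ) ^ (1 - (k : ℝ) / 2) : ℝ) : ℂ)) *
      ((p : ℝ) : ℂ) ^ (k - 2) = 1 := by
    have : ((p : ℝ) ^ (1 - (k : ℝ) / 2) * (p : ℝ) ^ (1 - (k : ℝ) / 2)) *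
        (p : ℝ) ^ (k - 2) = 1 := by
      rw [← Real.rpow_intCast, ← Real.rpow_add hp, ← Real.rpow_add hp]
      convert Real.rpow_zero (p : ℝ) using 2
      push_cast
      ring
    have hC := congrArg Complex.ofReal this
    simpa only [Complex.ofReal_mul, Complex.ofReal_zpow, Complex.ofReal_one] using hC
  rw [← one_mul (petersson k f g _), ← hc, mul_assoc, ← hs]
  simp only [petersson, atkinLehner_apply, map_mul, Complex.conj_ofReal]
  ring

/-- The change of variables `z ↦ w z` moves the integral to the `w`-translate of the domain; an
invariant function has the same integral over any two fundamental domains. -/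
theorem peterssonInner_atkinLehner [NeZero N] (f g : CuspSpace (p * N) k) :
    peterssonInner (atkinLehner p N k a b c d h f) (atkinLehner p N k a b c d h g) =
      peterssonInner f g := by
  have : NeZero p := ⟨(Fact.out : p.Prime).ne_zero⟩
  rw [peterssonInner_eq_setIntegral, peterssonInner_eq_setIntegral]
  simp only [petersson_atkinLehner]
  rw [setIntegral_smul_eq]
  refine (isFundamentalDomain_atkinLehnerMatrix_smul h).setIntegral_eq
    (isFundamentalDomain_cosetDomain (neg_one_mem_Gamma0 _)) fun g' z ↦ ?_
  obtain ⟨γ, hγ, hg⟩ := exists_smul_eq_of_mem_permImage g'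
  rw [hg]
  exact f.petersson_mapGL_smul g hγ z

end Unitary

/-! ### The Petersson inner product is positive definite -/

section Definite

instance : (volume : Measure ℍ).IsOpenPosMeasure where
  open_pos U hU hne h0 := by
    rw [volume_eq_lintegral, lintegral_eq_zero_iff (by fun_prop)] at h0
    have hopen := isOpenEmbedding_coe.isOpenMap U hU
    have h1 : volume (UpperHalfPlane.coe '' U) = 0 := by
      rw [Filter.EventuallyEq, ae_restrict_iff' hopen.measurableSet] at h0
      rw [measure_eq_zero_iff_ae_notMem]
      filter_upwards [h0] with z hz hzU
      have h2 := hz hzU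
      obtain ⟨w, -, rfl⟩ := hzU
      simp [w.im_ne_zero] at h2
    exact hopen.measure_ne_zero volume (hne.image _) h1

variable {M : ℕ} [NeZero M] {k : ℤ}

theorem petersson_self (f : ℍ → ℂ) (z : ℍ) :
    petersson k f f z = ((‖f z‖ ^ 2 * z.im ^ k : ℝ) : ℂ) := by
  rw [petersson, Complex.conj_mul']
  push_cast
  rfl

theorem peterssonInner_self (f : CuspSpace M k) :
    peterssonInner f f =
      ((∫ z in cosetDomain (Gamma0 M), ‖f z‖ ^ 2 * z.im ^ k : ℝ) : ℂ) := by
  rw [peterssonInner_eq_setIntegral, ← integral_complex_ofReal]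
  simp only [petersson_self]

theorem peterssonInner_conj_symm (f g : CuspSpace M k) :
    starRingEnd ℂ (peterssonInner g f) = peterssonInner f g := by
  rw [peterssonInner_eq_setIntegral, peterssonInner_eq_setIntegral, ← integral_conj]
  simp only [← petersson_symm]

/-- The nonvanishing set of `f` meets the fundamental domain in a null set. It is invariant, hence
null in `ℍ`, and open, hence empty. -/
theorem CuspSpace.eq_zero_of_peterssonInner_self_eq_zero (f : CuspSpace M k)
    (hf : peterssonInner f f = 0) : f = 0 := by
  rw [peterssonInner_self, Complex.ofReal_eq_zero] at hf
  have hint : IntegrableOn (fun z : ℍ ↦ ‖f z‖ ^ 2 * z.im ^ k) (cosetDomain (Gamma0 M)) := by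
    have := (integrableOn_cosetDomain_petersson f f).re
    refine this.congr (ae_of_all _ fun z ↦ ?_)
    beta_reduce
    rw [petersson_self]
    exact RCLike.ofReal_re (K := ℂ) _
  rw [setIntegral_eq_zero_iff_of_nonneg_ae
    (ae_of_all _ fun z ↦ mul_nonneg (by positivity) (zpow_nonneg z.im_pos.le k)) hint,
    Filter.EventuallyEq, ae_restrict_iff' measurableSet_cosetDomain] at hf
  have hnull : volume ({z : ℍ | f z ≠ 0} ∩ cosetDomain (Gamma0 M)) = 0 := by
    rw [measure_eq_zero_iff_ae_notMem]
    filter_upwards [hf] with z hz hz'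
    have h1 := hz hz'.2
    have h2 := hz'.1
    have h3 : z.im ^ k ≠ 0 := zpow_ne_zero k z.im_ne_zero
    simp_all
  have hinv (g : permImage (Gamma0 M)) :
      g • {z : ℍ | f z ≠ 0} = {z : ℍ | f z ≠ 0} := by
    ext z
    obtain ⟨γ, hγ, hg⟩ := exists_smul_eq_of_mem_permImage g⁻¹
    rw [Set.mem_smul_set_iff_inv_smul_mem, hg, Set.mem_ofPred_eq, Set.mem_ofPred_eq,
      ne_eq, ne_eq, ← petersson_self_eq_zero_iff (k := k) (f := f) (z := z),
      ← f.petersson_mapGL_smul f hγ z, petersson_self_eq_zero_iff]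
    rfl
  have h0 := (isFundamentalDomain_cosetDomain (neg_one_mem_Gamma0 M)).measure_zero_of_invariant
    _ hinv hnull
  have hopen : IsOpen {z : ℍ | f z ≠ 0} :=
    isOpen_ne_fun (CuspFormClass.holo f).continuous continuous_const
  ext z
  by_contra hz
  exact hopen.measure_ne_zero volume ⟨z, hz⟩ h0

/-- The Petersson inner product makes the space of cusp forms an inner product space. -/
@[reducible] noncomputable def peterssonCore (M : ℕ) [NeZero M] (k : ℤ) :
    InnerProductSpace.Core ℂ (CuspSpace M k) where
  inner := peterssonInner
  conj_inner_symm := peterssonInner_conj_symm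
  re_inner_nonneg f := by
    rw [peterssonInner_self]
    exact integral_nonneg fun z ↦ mul_nonneg (by positivity) (zpow_nonneg z.im_pos.le k)
  add_left f g h := by
    rw [← peterssonInner_conj_symm, peterssonInner_add_right, map_add, peterssonInner_conj_symm,
      peterssonInner_conj_symm]
  smul_left f g r := by
    rw [← peterssonInner_conj_symm, peterssonInner_smul_right, map_mul, peterssonInner_conj_symm]
  definite f := f.eq_zero_of_peterssonInner_self_eq_zero

theorem isCompl_pNew_pOld (p N : ℕ) [Fact p.Prime] [NeZero N] (k : ℤ) :
    IsCompl (pNew p N k) (pOld p N k) := by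
  have : NeZero p := ⟨(Fact.out : p.Prime).ne_zero⟩
  have := CuspSpace.finiteDimensional (p * N) k
  let C := peterssonCore (p * N) k
  let _ : NormedAddCommGroup (CuspSpace (p * N) k) := C.toNormedAddCommGroup
  let _ : InnerProductSpace ℂ (CuspSpace (p * N) k) := InnerProductSpace.ofCore C.toCore
  have hnew : pNew p N k = (pOld p N k)ᗮ := by
    ext f
    exact (Submodule.mem_orthogonal _ f).symm
  rw [hnew]
  exact (Submodule.isCompl_orthogonal (K := pOld p N k)).symm

end Definite

/-! ### Traces -/

section Trace

variable {K V : Type*} [Field K] [AddCommGroup V] [Module K V] [FiniteDimensional K V]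

/-- Both diagonal blocks of `f` vanish. -/
theorem LinearMap.trace_eq_zero_of_isCompl_of_swap {A B : Submodule K V} (hAB : IsCompl A B)
    (f : V →ₗ[K] V) (hA : ∀ x ∈ A, f x ∈ B) (hB : ∀ x ∈ B, f x ∈ A) :
    LinearMap.trace K V f = 0 := by
  have hint : DirectSum.IsInternal (fun i : Bool ↦ cond i A B) :=
    (DirectSum.isInternal_submodule_iff_isCompl _ (i := true) (j := false) (by simp)
      (by ext i; cases i <;> simp)).mpr hAB
  exact LinearMap.trace_eq_zero_of_mapsTo_ne hint (fun i ↦ !i) (by simp)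
    fun i ↦ by cases i <;> assumption

theorem LinearMap.trace_eq_trace_restrict_add_of_isCompl {A B : Submodule K V}
    (hAB : IsCompl A B) (f : V →ₗ[K] V) (hA : ∀ x ∈ A, f x ∈ A) (hB : ∀ x ∈ B, f x ∈ B) :
    LinearMap.trace K V f =
      LinearMap.trace K A (f.restrict hA) + LinearMap.trace K B (f.restrict hB) := by
  have hint : DirectSum.IsInternal (fun i : Bool ↦ cond i A B) :=
    (DirectSum.isInternal_submodule_iff_isCompl _ (i := true) (j := false) (by simp)
      (by ext i; cases i <;> simp)).mpr hAB
  rw [LinearMap.trace_eq_sum_trace_restrict hint (f := f) fun i ↦ by cases i <;> assumption]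
  exact Fintype.sum_bool _

end Trace

/-! ### Stability of the new space and the trace identity -/

theorem atkinLehner_mem_pNew {p N : ℕ} [Fact p.Prime] [NeZero N] {k : ℤ} {a b c d : ℤ}
    (h : (p : ℤ) * a * d - N * b * c = 1) {f : CuspSpace (p * N) k} (hf : f ∈ pNew p N k) :
    atkinLehner p N k a b c d h f ∈ pNew p N k := by
  intro g hg
  -- Writing `g = W_p (W_p g)` gives `⟨g, W_p f⟩ = ⟨W_p g, f⟩`, and `W_p g` is old.
  rw [← atkinLehner_atkinLehner_of_mem_pOld h hg, peterssonInner_atkinLehner]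
  exact hf _ (atkinLehner_mem_pOld h hg)

theorem trace_atkinLehner_pOld {p N : ℕ} [Fact p.Prime] [NeZero N] {k : ℤ} {a b c d : ℤ}
    (h : (p : ℤ) * a * d - N * b * c = 1) :
    LinearMap.trace ℂ (pOld p N k) ((atkinLehner p N k a b c d h).restrict
      fun _ ↦ atkinLehner_mem_pOld h) = 0 := by
  have : NeZero p := ⟨(Fact.out : p.Prime).ne_zero⟩
  have := CuspSpace.finiteDimensional (p * N) k
  refine LinearMap.trace_eq_zero_of_isCompl_of_swap
    (A := (oldForms p N k).submoduleOf (pOld p N k))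
    (B := (scaledOldForms p N k).submoduleOf (pOld p N k)) ⟨?_, ?_⟩ _
    (fun f hf ↦ atkinLehner_mem_scaledOldForms h hf) fun f hf ↦ atkinLehner_mem_oldForms h hf
  · rw [Submodule.disjoint_def]
    intro f h₁ h₂
    have h₃ : (f : CuspSpace (p * N) k) = 0 :=
      Submodule.disjoint_def.mp (disjoint_oldForms_scaledOldForms h) (f : CuspSpace (p * N) k)
        h₁ h₂
    exact Subtype.ext h₃
  · rw [codisjoint_iff, eq_top_iff]
    rintro ⟨f, hf⟩ -
    obtain ⟨f₁, h₁, f₂, h₂, rfl⟩ := Submodule.mem_sup.mp (pOld_eq_sup p N k ▸ hf)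
    have hle₁ : f₁ ∈ pOld p N k := pOld_eq_sup p N k ▸ Submodule.mem_sup_left h₁
    have hle₂ : f₂ ∈ pOld p N k := pOld_eq_sup p N k ▸ Submodule.mem_sup_right h₂
    exact Submodule.add_mem_sup (show (⟨f₁, hle₁⟩ : pOld p N k) ∈ _ from h₁)
      (show (⟨f₂, hle₂⟩ : pOld p N k) ∈ _ from h₂)

theorem mainTheorem8 (p N : ℕ) [Fact p.Prime] [NeZero N] (hpN : p.Coprime N) (k : ℤ)
    (a b c d : ℤ) (h : (p : ℤ) * a * d - N * b * c = 1) :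
    FiniteDimensional ℂ (CuspSpace (p * N) k) ∧
    (∃ hnew : ∀ f ∈ pNew p N k, atkinLehner p N k a b c d h f ∈ pNew p N k,
      LinearMap.trace ℂ (pNew p N k) ((atkinLehner p N k a b c d h).restrict hnew) =
        LinearMap.trace ℂ (CuspSpace (p * N) k) (atkinLehner p N k a b c d h)) ∧
    (∃ hold : ∀ f ∈ pOld p N k, atkinLehner p N k a b c d h f ∈ pOld p N k,
      LinearMap.trace ℂ (pOld p N k) ((atkinLehner p N k a b c d h).restrict hold) = 0) := by
  have : NeZero p := ⟨(Fact.out : p.Prime).ne_zero⟩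
  have hfin := CuspSpace.finiteDimensional (p * N) k
  have hold := trace_atkinLehner_pOld (k := k) h
  refine ⟨hfin, ⟨fun _ ↦ atkinLehner_mem_pNew h, ?_⟩, ⟨fun _ ↦ atkinLehner_mem_pOld h, hold⟩⟩
  rw [LinearMap.trace_eq_trace_restrict_add_of_isCompl (isCompl_pNew_pOld p N k) _
    (fun _ ↦ atkinLehner_mem_pNew h) fun _ ↦ atkinLehner_mem_pOld h, hold, add_zero]
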